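/- Let $(R,\mathfrak m)$ be a complete discrete valuation ring with fraction field $K$, let $G$ be a connected scheme that is smooth and separated over $R$, and let $e\colon \operatorname{Spec}(R)\to G$ be a section of the structure morphism. Let $Z\subsetneq G$ be a closed subscheme with $e(\operatorname{Spec}(R))\subset Z$, that is, such that $e$ factors through $Z$. Then for each positive integer $a$ there exist an integer $b>a$ and a section $\sigma\colon \operatorname{Spec}(R)\to G$ such that 1. $\sigma\equiv e \bmod \mathfrak m^a$, i.e. $\sigma$ and $e$ have the same restriction to $\operatorname{Spec}(R/\mathfrak m^a)$; 2. $\sigma(\operatorname{Spec}(R/\mathfrak m^b))\not\subset Z$ scheme-theoretically, i.e. the restriction of $\sigma$ to $\operatorname{Spec}(R/\mathfrak m^b)$ does not factor through $Z$. Moreover, with $U=G\setminus Z$ the open complement, the restriction of $\sigma$ to $\operatorname{Spec}(K)$ factors through $U$, so that $\sigma$ defines a point of $U(K)$. -/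

import Mathlib

open CategoryTheory AlgebraicGeometry

universe u

namespace JetSeparation

/-- The closed immersion `Spec (R ⧸ I) ⟶ Spec R`. -/
noncomputable def specQuot (R : Type u) [CommRing R] (I : Ideal R) :
    Spec (.of (R ⧸ I)) ⟶ Spec (.of R) :=
  Spec.map (CommRingCat.ofHom (Ideal.Quotient.mk I))

/-- The morphism `Spec K ⟶ Spec R` given by the structure map of an `R`-algebra `K`. -/
noncomputable def specAlg (R K : Type u) [CommRing R] [CommRing K] [Algebra R K] :
    Spec (.of K) ⟶ Spec (.of R) :=
  Spec.map (CommRingCat.ofHom (algebraMap R K))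

/-- The morphism `f : T ⟶ G` factors, as a morphism of schemes, through `i : Z ⟶ G`. For a closed
subscheme `Z` of `G` this is the scheme-theoretic condition `f(T) ⊂ Z`. -/
def FactorsThrough {T Z G : Scheme.{u}} (f : T ⟶ G) (i : Z ⟶ G) : Prop :=
  ∃ g : T ⟶ Z, g ≫ i = f

/-- The open complement of a closed subscheme. -/
def complement {Z G : Scheme.{u}} (i : Z ⟶ G) [IsClosedImmersion i] : G.Opens :=
  ⟨(Set.range i)ᶜ, i.isClosedEmbedding.isClosed_range.isOpen_compl⟩

end JetSeparation

/-! Near the closed point of `e`, `G` has a chart `Spec B` with `B` a domain standard étale over an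
affine space over `R`. As `R` is local, `e` becomes an `R`-point `φ` of `B`. Connectedness and the
integral charts prevent `Z` from containing a whole chart, so some `f ≠ 0` in `B` vanishes on `Z`.
This `f` divides a nonzero polynomial `r` in the base coordinates. Moving the coordinates within
their classes mod `𝔪 ^ a` makes `r` nonzero, and Hensel's lemma lifts the moved point to `ψ` with `ψ
f ≠ 0`. Hence the generic point avoids `Z`, and Krull's intersection theorem gives `b`. -/

open Polynomial in
theorem StandardEtalePresentation.exists_dvd_mul_pow_of_aeval_eq_zero {P T : Type*} [CommRing P]
    [CommRing T] [Algebra P T] (E : StandardEtalePresentation P T) (A : P[X])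
    (hA : aeval E.x A = 0) : ∃ m : ℕ, E.f ∣ E.g ^ m * A := by
  let e := E.equivRing.trans E.P.equivAwayAdjoinRoot
  have hx : e E.x = algebraMap (AdjoinRoot E.f) _ (.root E.f) := by
    simpa [e, StandardEtalePair.equivAwayAdjoinRoot] using StandardEtalePair.lift_X ..
  have h : algebraMap (AdjoinRoot E.f) (Localization.Away (AdjoinRoot.mk E.f E.g))
      (AdjoinRoot.mk E.f A) = 0 := by
    have := congr(e $hA)
    rwa [map_zero, ← aeval_algHom_apply, hx, aeval_algebraMap_apply, AdjoinRoot.aeval_eq] at this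
  obtain ⟨⟨_, m, rfl⟩, hm⟩ := (IsLocalization.map_eq_zero_iff
    (.powers (AdjoinRoot.mk E.f E.g)) _ _).mp h
  refine ⟨m, ?_⟩
  simpa [← map_pow, ← map_mul, AdjoinRoot.mk_eq_zero] using hm

open Polynomial in
/-- A standard étale algebra over a factorial domain is, locally on its spectrum, a domain. -/
theorem StandardEtalePresentation.exists_isDomain_localizationAway {P T : Type*} [CommRing P]
    [IsDomain P] [UniqueFactorizationMonoid P] [CommRing T] [Algebra P T]
    (E : StandardEtalePresentation P T) (q : Ideal T) [hq : q.IsPrime] :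
    ∃ h ∉ q, IsDomain (Localization.Away h) := by
  have hgq : aeval E.x E.g ∉ q := fun h ↦ hq.ne_top (q.eq_top_of_isUnit_mem h E.hasMap.2)
  have hdq : aeval E.x E.f.derivative ∉ q := fun h ↦
    hq.ne_top (q.eq_top_of_isUnit_mem h E.hasMap.isUnit_derivative_f)
  -- `f₁` cuts out the component through `q`. Since `f'` is nonzero at `q`, the cofactor `h₀` does
  -- not vanish there, and inverting it removes the other components.
  obtain ⟨f₁, hf₁, hdvd, hf₁q⟩ : ∃ f₁ : P[X], Prime f₁ ∧ f₁ ∣ E.f ∧ aeval E.x f₁ ∈ q := by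
    have hprod := UniqueFactorizationMonoid.factors_prod E.monic_f.ne_zero
    have : (UniqueFactorizationMonoid.factors E.f).prod ∈ q.comap (aeval E.x : P[X] →ₐ[P] T) := by
      have h0 : E.f ∈ q.comap (aeval E.x : P[X] →ₐ[P] T) := by simp [E.hasMap.1]
      exact Ideal.mem_of_dvd _ hprod.symm.dvd h0
    obtain ⟨f₁, hmem, h⟩ := (Ideal.IsPrime.multiset_prod_mem_iff_exists_mem inferInstance _).mp this
    exact ⟨f₁, UniqueFactorizationMonoid.prime_of_factor _ hmem,
      UniqueFactorizationMonoid.dvd_of_mem_factors hmem, h⟩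
  obtain ⟨h₀, hh₀⟩ := hdvd
  have hh₀q : aeval E.x h₀ ∉ q := by
    intro h
    apply hdq
    rw [hh₀, derivative_mul, map_add, map_mul, map_mul]
    exact q.add_mem (q.mul_mem_left _ h) (q.mul_mem_right _ hf₁q)
  refine ⟨aeval E.x h₀, hh₀q, ?_⟩
  set h := aeval E.x h₀
  have hndvd (A : P[X]) (hA : aeval E.x A ∉ q) : ¬ f₁ ∣ A := by
    rintro ⟨c, rfl⟩
    exact hA (by rw [map_mul]; exact q.mul_mem_right _ hf₁q)
  -- The kernel of `P[X] → T_h` is the prime ideal `(f₁)`.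
  have key (A : P[X]) : algebraMap T (Localization.Away h) (aeval E.x A) = 0 ↔ f₁ ∣ A := by
    constructor
    · intro hA
      obtain ⟨⟨_, k, rfl⟩, hk⟩ := (IsLocalization.map_eq_zero_iff (.powers h) _ _).mp hA
      obtain ⟨m, hm⟩ := E.exists_dvd_mul_pow_of_aeval_eq_zero (h₀ ^ k * A)
        (by rw [map_mul, map_pow]; exact hk)
      have := (Dvd.intro _ hh₀.symm).trans hm
      rcases hf₁.dvd_or_dvd this with h' | h'
      · exact (hndvd _ hgq (hf₁.dvd_of_dvd_pow h')).elim
      · rcases hf₁.dvd_or_dvd h' with h' | h'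
        · exact (hndvd _ hh₀q (hf₁.dvd_of_dvd_pow h')).elim
        · exact h'
    · rintro ⟨c, rfl⟩
      refine (IsLocalization.map_eq_zero_iff (.powers h) _ _).mpr
        ⟨⟨h, Submonoid.mem_powers h⟩, ?_⟩
      have : aeval E.x (h₀ * (f₁ * c)) = 0 := by
        rw [← mul_assoc, mul_comm h₀, ← hh₀, map_mul, E.hasMap.1, zero_mul]
      simpa [h] using this
  have repr (s : Localization.Away h) : ∃ (u : Localization.Away h) (A : P[X]), IsUnit u ∧
      s * u = algebraMap T (Localization.Away h) (aeval E.x A) := by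
    obtain ⟨⟨t, v⟩, ht⟩ := IsLocalization.surj (.powers h) s
    obtain ⟨A, m, hA⟩ := E.exists_mul_aeval_x_g_pow_eq_aeval_x t
    refine ⟨algebraMap T _ v * algebraMap T _ (aeval E.x E.g ^ m), A,
      (IsLocalization.map_units _ v).mul ((E.hasMap.2.pow m).map _), ?_⟩
    rw [← mul_assoc, ht, ← map_mul, hA]
  have : Nontrivial (Localization.Away h) := by
    refine ⟨1, 0, fun h1 ↦ hf₁.not_isUnit ?_⟩
    exact isUnit_of_dvd_one ((key 1).mp (by simpa using h1))
  have : NoZeroDivisors (Localization.Away h) := by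
    refine ⟨fun {s t} hst ↦ ?_⟩
    obtain ⟨u, A, hu, hA⟩ := repr s
    obtain ⟨v, B, hv, hB⟩ := repr t
    have hAB : f₁ ∣ A * B := by
      rw [← key, map_mul, map_mul, ← hA, ← hB, mul_mul_mul_comm, hst, zero_mul]
    refine (hf₁.dvd_or_dvd hAB).imp (fun h' ↦ ?_) (fun h' ↦ ?_)
    · rwa [← key, ← hA, hu.mul_left_eq_zero] at h'
    · rwa [← key, ← hB, hv.mul_left_eq_zero] at h'
  exact NoZeroDivisors.to_isDomain _

/-- A nonzero element of a standard étale domain over `P` divides the image of a nonzero element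
of `P`. -/
theorem StandardEtalePresentation.exists_dvd_algebraMap {P B : Type*} [CommRing P]
    [CommRing B] [IsDomain B] [Algebra P B] (E : StandardEtalePresentation P B) {f : B}
    (hf : f ≠ 0) : ∃ r : P, r ≠ 0 ∧ f ∣ algebraMap P B r := by
  have := (algebraMap P B).domain_nontrivial
  obtain ⟨A, m, hA⟩ := E.exists_mul_aeval_x_g_pow_eq_aeval_x f
  have hint : IsIntegral P (Polynomial.aeval E.x A) := by
    have hx : IsIntegral P E.x := ⟨E.f, E.monic_f, E.hasMap.1⟩
    exact .of_mem_of_fg _ hx.fg_adjoin_singleton _ (Polynomial.aeval_mem_adjoin_singleton _ _)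
  -- `A(x)` is `f` times a unit, and a nonzero integral element of an ideal forces a nonzero
  -- contraction to `P`.
  have hne := Ideal.comap_ne_bot_of_integral_mem (I := Ideal.span {f})
    (x := Polynomial.aeval E.x A) (hA ▸ mul_ne_zero hf (pow_ne_zero _ E.hasMap.2.ne_zero))
    (hA ▸ Ideal.mul_mem_right _ _ (Ideal.mem_span_singleton_self f)) hint
  obtain ⟨r, hr, hr0⟩ := Submodule.exists_mem_ne_zero_of_ne_bot hne
  exact ⟨r, hr0, Ideal.mem_span_singleton.mp hr⟩

/-! ### Moving sections by Hensel's lemma -/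

/-- Hensel's lemma with an approximation to prescribed order. -/
theorem IsLocalRing.exists_isRoot_sub_mem_pow {R : Type*} [CommRing R] [IsLocalRing R]
    [IsAdicComplete (maximalIdeal R) R] (F : Polynomial R) (hF : F.Monic) (y₀ : R) {a : ℕ}
    (ha : 0 < a) (h₀ : F.eval y₀ ∈ maximalIdeal R ^ a) (h₁ : IsUnit (F.derivative.eval y₀)) :
    ∃ y, F.eval y = 0 ∧ y - y₀ ∈ maximalIdeal R ^ a := by
  obtain ⟨y, hy, hyy⟩ := HenselianRing.is_henselian (I := maximalIdeal R) F hF y₀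
    (Ideal.pow_le_self ha.ne' h₀) (h₁.map _)
  refine ⟨y, hy, ?_⟩
  -- Taylor expansion at `y₀` shows that `y - y₀` times a unit is `-F(y₀)`, which improves the
  -- congruence from `𝔪` to `𝔪 ^ a`.
  obtain ⟨c, hc⟩ := Polynomial.exists_mul_sq_add_linear_part_eq_eval_add F y₀ (y - y₀)
  rw [add_sub_cancel, hy.eq_zero] at hc
  have hu : IsUnit (c * (y - y₀) + F.derivative.eval y₀) := by
    rw [← IsLocalRing.notMem_maximalIdeal] at h₁ ⊢
    exact fun h ↦ h₁ ((Ideal.add_mem_iff_right _ (Ideal.mul_mem_left _ _ hyy)).mp h)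
  rw [← Ideal.unit_mul_mem_iff_mem _ hu]
  convert! neg_mem h₀ using 1
  linear_combination hc

/-- A section of a standard étale domain over affine space over a complete discrete valuation ring
can be moved, within its residue class modulo a power of the maximal ideal, away from the zero locus
of a given nonzero element. -/
theorem StandardEtalePresentation.exists_algHom_sub_mem_pow_ne_zero {R B : Type*} [CommRing R]
    [IsDomain R] [IsDiscreteValuationRing R] [IsAdicComplete (IsLocalRing.maximalIdeal R) R]
    [CommRing B] [IsDomain B] [Algebra R B] {n : ℕ} [Algebra (MvPolynomial (Fin n) R) B]
    [IsScalarTower R (MvPolynomial (Fin n) R) B]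
    (E : StandardEtalePresentation (MvPolynomial (Fin n) R) B) (φ : B →ₐ[R] R) {f : B}
    (hf : f ≠ 0) {a : ℕ} (ha : 0 < a) :
    ∃ ψ : B →ₐ[R] R, (∀ z, ψ z - φ z ∈ IsLocalRing.maximalIdeal R ^ a) ∧ ψ f ≠ 0 := by
  set m := IsLocalRing.maximalIdeal R
  obtain ⟨r, hr, c, hc⟩ := E.exists_dvd_algebraMap hf
  let φ₀ : MvPolynomial (Fin n) R →ₐ[R] R := φ.comp (IsScalarTower.toAlgHom R _ B)
  let t₀ (i : Fin n) : R := φ₀ (.X i)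
  have hφ₀ : φ₀ = MvPolynomial.aeval t₀ := by ext; simp [t₀]
  have hinf (x : R) : {y : R | y - x ∈ m ^ a}.Infinite := by
    have hR : Infinite R := by
      by_contra h
      rw [not_infinite_iff_finite] at h
      exact IsDiscreteValuationRing.not_isField R (Finite.isField_of_domain R)
    obtain ⟨ϖ, hϖ, hϖ0⟩ := Submodule.exists_mem_ne_zero_of_ne_bot
      (pow_ne_zero a (IsDiscreteValuationRing.not_a_field R))
    refine (Set.infinite_range_of_injective (f := fun z : R ↦ z * ϖ + x)
      fun z w h ↦ mul_right_cancel₀ hϖ0 (add_right_cancel h)).mono ?_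
    rintro _ ⟨z, rfl⟩
    simpa using Ideal.mul_mem_left _ _ hϖ
  -- A nonzero polynomial over a domain cannot vanish on a product of infinite sets.
  obtain ⟨t, ht, hrt⟩ : ∃ t : Fin n → R, (∀ i, t i - t₀ i ∈ m ^ a) ∧ MvPolynomial.eval t r ≠ 0 := by
    by_contra! h
    refine hr (MvPolynomial.funext_set _ (fun i ↦ hinf (t₀ i)) fun t ht ↦ ?_)
    rw [map_zero]
    exact h t fun i ↦ ht i trivial
  have hcongr (q : MvPolynomial (Fin n) R) : MvPolynomial.eval t q - φ₀ q ∈ m ^ a := by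
    rw [← Ideal.Quotient.eq, hφ₀]
    have : (Ideal.Quotient.mkₐ R (m ^ a)).comp (MvPolynomial.aeval t) =
        (Ideal.Quotient.mkₐ R (m ^ a)).comp (MvPolynomial.aeval t₀) := by
      ext i
      simpa using Ideal.Quotient.eq.mpr (ht i)
    simpa [MvPolynomial.aeval_eq_eval] using DFunLike.congr_fun this q
  let y₀ : R := φ E.x
  have hmk : (Ideal.Quotient.mk (m ^ a)).comp (MvPolynomial.eval t) =
      (Ideal.Quotient.mk (m ^ a)).comp φ₀.toRingHom :=
    RingHom.ext fun q ↦ Ideal.Quotient.eq.mpr (hcongr q)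
  have heval (F : Polynomial (MvPolynomial (Fin n) R)) :
      F.eval₂ (MvPolynomial.eval t) y₀ - φ (Polynomial.aeval E.x F) ∈ m ^ a := by
    rw [← Ideal.Quotient.eq, Polynomial.hom_eval₂, hmk, ← Polynomial.hom_eval₂,
      Polynomial.aeval_def]
    congr 1
    exact (Polynomial.hom_eval₂ _ _ φ.toRingHom _).symm
  have hunit {F : Polynomial (MvPolynomial (Fin n) R)} (hF : IsUnit (Polynomial.aeval E.x F)) :
      IsUnit (F.eval₂ (MvPolynomial.eval t) y₀) := by
    have h1 := hF.map φ
    rw [← IsLocalRing.notMem_maximalIdeal] at h1 ⊢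
    exact fun h ↦ h1 ((Submodule.sub_mem_iff_right _ h).mp (Ideal.pow_le_self ha.ne' (heval F)))
  obtain ⟨y, hy, hyy⟩ := IsLocalRing.exists_isRoot_sub_mem_pow (E.f.map (MvPolynomial.eval t))
    (E.monic_f.map _) y₀ ha
    (by simpa [E.hasMap.1, Polynomial.eval_map] using heval E.f)
    (by
      rw [Polynomial.derivative_map, Polynomial.eval_map]
      exact hunit E.hasMap.isUnit_derivative_f)
  have hyg : IsUnit (E.g.eval₂ (MvPolynomial.eval t) y) := by
    have h1 := hunit E.hasMap.2
    rw [← IsLocalRing.notMem_maximalIdeal] at h1 ⊢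
    intro h
    have h2 := Polynomial.sub_dvd_eval_sub y y₀ (E.g.map (MvPolynomial.eval t))
    rw [Polynomial.eval_map, Polynomial.eval_map] at h2
    exact h1 ((Submodule.sub_mem_iff_right _ h).mp
      (Ideal.mem_of_dvd _ h2 (Ideal.pow_le_self ha.ne' hyy)))
  obtain ⟨ψ, hψ, hψx⟩ : ∃ ψ : B →+* R,
      ψ.comp (algebraMap _ B) = MvPolynomial.eval t ∧ ψ E.x = y := by
    algebraize [MvPolynomial.eval t]
    have hmap : E.HasMap y :=
      ⟨by rwa [Polynomial.aeval_def, ← Polynomial.eval_map], hyg⟩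
    let ψ := (E.P.lift y hmap).comp E.equivRing.toAlgHom
    exact ⟨ψ.toRingHom, ψ.comp_algebraMap, by simp [ψ]⟩
  have hψR (x : R) : ψ (algebraMap R B x) = x := by
    rw [IsScalarTower.algebraMap_apply R (MvPolynomial (Fin n) R) B]
    simpa using congr($hψ (algebraMap R _ x))
  refine ⟨{ ψ with commutes' := hψR }, fun z ↦ ?_, fun h ↦ hrt ?_⟩
  · rw [← Ideal.Quotient.eq]
    have hcomp : ((Ideal.Quotient.mk (m ^ a)).comp ψ).comp (algebraMap _ B) =
        ((Ideal.Quotient.mk (m ^ a)).comp φ.toRingHom).comp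
          (algebraMap (MvPolynomial (Fin n) R) B) := by
      rw [RingHom.comp_assoc, hψ, hmk]
      rfl
    -- Mod `m ^ a`, both points are algebra maps over the polynomial ring, hence determined by the
    -- image of `E.x`.
    algebraize [((Ideal.Quotient.mk (m ^ a)).comp φ.toRingHom).comp
      (algebraMap (MvPolynomial (Fin n) R) B)]
    let ψ' : B →ₐ[MvPolynomial (Fin n) R] R ⧸ m ^ a :=
      { (Ideal.Quotient.mk (m ^ a)).comp ψ with commutes' := fun q ↦ congr($hcomp q) }
    let φ' : B →ₐ[MvPolynomial (Fin n) R] R ⧸ m ^ a :=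
      { (Ideal.Quotient.mk (m ^ a)).comp φ.toRingHom with commutes' := fun q ↦ rfl }
    have : ψ' = φ' := E.hom_ext (by
      change Ideal.Quotient.mk _ (ψ E.x) = Ideal.Quotient.mk _ (φ E.x)
      rw [hψx]
      exact Ideal.Quotient.eq.mpr hyy)
    exact DFunLike.congr_fun this z
  · rw [← hψ, RingHom.comp_apply, hc, map_mul]
    exact (congrArg (· * ψ c) h).trans (zero_mul _)

/-! ### Integral charts and proper closed subschemes -/

/-- A smooth morphism to the spectrum of a factorial domain is, locally on the source, given by a
domain which is standard étale over an affine space. -/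
theorem AlgebraicGeometry.Smooth.exists_spec_isStandardEtale_mvPolynomial {R : Type u} [CommRing R]
    [IsDomain R] [UniqueFactorizationMonoid R] {G : Scheme.{u}} (p : G ⟶ Spec (.of R)) [Smooth p]
    (x : G) :
    ∃ (B : Type u) (_ : CommRing B) (_ : IsDomain B) (_ : Algebra R B) (n : ℕ)
      (_ : Algebra (MvPolynomial (Fin n) R) B) (_ : IsScalarTower R (MvPolynomial (Fin n) R) B)
      (_ : Algebra.IsStandardEtale (MvPolynomial (Fin n) R) B)
      (j : Spec (.of B) ⟶ G) (_ : IsOpenImmersion j), x ∈ Set.range j ∧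
        j ≫ p = Spec.map (CommRingCat.ofHom (algebraMap R B)) := by
  obtain ⟨S, j₀, hj₀, ⟨q, rfl⟩, -⟩ :=
    Scheme.exists_affine_mem_range_and_range_subset (x := x) (U := ⊤) trivial
  obtain ⟨ρ, hρ⟩ := Spec.map_surjective (j₀ ≫ p)
  have hsmooth : Smooth (Spec.map ρ) := hρ ▸ inferInstance
  rw [HasRingHomProperty.Spec_iff (P := @Smooth)] at hsmooth
  algebraize [ρ.hom]
  have := q.isPrime
  obtain ⟨f, hfq, n, _, _, hE⟩ :=
    Algebra.IsSmoothAt.exists_isStandardEtale_mvPolynomial (R := R) (p := q.asIdeal)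
  let T := Localization.Away f
  obtain ⟨q', hq'⟩ : q ∈ Set.range (PrimeSpectrum.comap (algebraMap S T)) := by
    rw [PrimeSpectrum.localization_away_comap_range T f]
    exact hfq
  obtain ⟨h, hhq, _⟩ :=
    hE.nonempty_standardEtalePresentation.some.exists_isDomain_localizationAway q'.asIdeal
  let B := Localization.Away h
  obtain ⟨q'', hq''⟩ : q' ∈ Set.range (PrimeSpectrum.comap (algebraMap T B)) := by
    rw [PrimeSpectrum.localization_away_comap_range B h]
    exact hhq
  let j : Spec (.of B) ⟶ G := Spec.map (CommRingCat.ofHom (algebraMap T B)) ≫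
    Spec.map (CommRingCat.ofHom (algebraMap S T)) ≫ j₀
  have h₁ : IsOpenImmersion (Spec.map (CommRingCat.ofHom (algebraMap T B))) :=
    .of_isLocalization h
  have h₂ : IsOpenImmersion (Spec.map (CommRingCat.ofHom (algebraMap S T))) :=
    .of_isLocalization f
  refine ⟨B, inferInstance, inferInstance, inferInstance, n, inferInstance, inferInstance,
    .of_isLocalizationAway (S := T) h, j, inferInstance, ⟨q'', ?_⟩, ?_⟩
  · rw [← hq', ← hq'']
    simp [j]
    rfl
  · simp only [j, Category.assoc, ← hρ, ← Spec.map_comp]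
    rfl

/-- In a connected scheme with irreducible charts, a closed subset containing a nonempty open
set is everything. -/
theorem IsClosed.eq_univ_of_forall_isPreirreducible {X : Type*} [TopologicalSpace X]
    [PreconnectedSpace X]
    (hX : ∀ x : X, ∃ U : Set X, IsOpen U ∧ x ∈ U ∧ IsPreirreducible U)
    {Z : Set X} (hZ : IsClosed Z) (hZ' : (interior Z).Nonempty) : Z = Set.univ := by
  have hclosed : IsClosed (interior Z) := by
    refine isClosed_of_closure_subset fun x hx ↦ ?_
    obtain ⟨U, hU, hxU, hUirr⟩ := hX x
    refine mem_interior.mpr ⟨U, ?_, hU, hxU⟩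
    by_contra hUZ
    obtain ⟨y, hyU, hyZ⟩ := Set.not_subset.mp hUZ
    obtain ⟨w, hw⟩ := mem_closure_iff.mp hx U hU hxU
    -- In an irreducible chart, two nonempty opens, here from `interior Z` and the complement of
    -- `Z`, must meet.
    obtain ⟨v, -, hv, hv'⟩ := hUirr _ _ isOpen_interior hZ.isOpen_compl ⟨w, hw⟩ ⟨y, hyU, hyZ⟩
    exact hv' (interior_subset hv)
  have := (IsClopen.eq_univ ⟨hclosed, isOpen_interior⟩ hZ')
  exact Set.eq_univ_of_univ_subset (this ▸ interior_subset)

/-- A morphism from the spectrum of a local ring lands in any open set containing the image of the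
closed point. -/
theorem AlgebraicGeometry.range_subset_range_of_closedPoint_mem {R : Type u} [CommRing R]
    [IsLocalRing R]
    {G V : Scheme.{u}} (e : Spec (.of R) ⟶ G) (j : V ⟶ G) [IsOpenImmersion j]
    (h : e (IsLocalRing.closedPoint R) ∈ Set.range j) :
    Set.range e ⊆ Set.range j := by
  rintro _ ⟨y, rfl⟩
  exact ((IsLocalRing.specializes_closedPoint y).map e.continuous).mem_open
    j.isOpenEmbedding.isOpen_range h

namespace JetSeparation

/-- Equations of a closed subscheme in an affine chart vanish on the morphisms that factor
through it. -/
theorem FactorsThrough.map_eq_zero {B C : Type u} [CommRing B] [CommRing C] {G Z : Scheme.{u}}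
    {i : Z ⟶ G} {j : Spec (.of B) ⟶ G} {J : Ideal B} (ε : Limits.pullback i j ≅ Spec (.of (B ⧸ J)))
    (hε : Limits.pullback.snd i j = ε.hom ≫ Spec.map (CommRingCat.ofHom (Ideal.Quotient.mk J)))
    {χ : B →+* C} (h : FactorsThrough (Spec.map (CommRingCat.ofHom χ) ≫ j) i) {f : B}
    (hf : f ∈ J) : χ f = 0 := by
  obtain ⟨g, hg⟩ := h
  obtain ⟨θ, hθ⟩ := Spec.map_surjective (Limits.pullback.lift g _ hg ≫ ε.hom)
  have : CommRingCat.ofHom χ = CommRingCat.ofHom (Ideal.Quotient.mk J) ≫ θ := by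
    apply Spec.map_injective
    rw [Spec.map_comp, hθ, Category.assoc, ← hε, Limits.pullback.lift_snd]
  have h2 := congr($(this).hom f)
  simpa [Ideal.Quotient.eq_zero_iff_mem.mpr hf] using h2

/-- A proper closed subscheme of a connected scheme that is smooth over a factorial domain is
proper on every nonempty chart. -/
theorem not_range_subset_of_smooth {R : Type u} [CommRing R] [IsDomain R]
    [UniqueFactorizationMonoid R] {G : Scheme.{u}} [ConnectedSpace G] (p : G ⟶ Spec (.of R))
    [Smooth p] {Z : Scheme.{u}} (i : Z ⟶ G) [IsClosedImmersion i] (hZ : ¬ IsIso i)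
    {V : Scheme.{u}} [Nonempty V] (j : V ⟶ G) [IsOpenImmersion j] :
    ¬ Set.range j ⊆ Set.range i := by
  intro hji
  have huniv : Set.range i = Set.univ := by
    refine IsClosed.eq_univ_of_forall_isPreirreducible (fun x ↦ ?_)
      i.isClosedEmbedding.isClosed_range ?_
    · obtain ⟨B, _, _, _, n, _, _, _, j', _, hx, -⟩ :=
        Smooth.exists_spec_isStandardEtale_mvPolynomial p x
      refine ⟨_, j'.isOpenEmbedding.isOpen_range, hx, ?_⟩
      rw [← Set.image_univ]
      exact (PreirreducibleSpace.isPreirreducible_univ (X := Spec (.of B))).image _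
        j'.continuous.continuousOn
    · exact (Set.range_nonempty j).mono
        (interior_maximal hji j.isOpenEmbedding.isOpen_range)
  have : Surjective i := ⟨Set.range_eq_univ.mp huniv⟩
  -- Stalks of integral charts are reduced, and a surjective closed immersion into a reduced scheme
  -- is an isomorphism.
  have : ∀ x : G, _root_.IsReduced (G.presheaf.stalk x) := by
    intro x
    obtain ⟨B, _, _, _, n, _, _, _, j', _, ⟨y, rfl⟩, -⟩ :=
      Smooth.exists_spec_isStandardEtale_mvPolynomial p x
    exact isReduced_of_injective (j'.stalkMap y).hom
      (ConcreteCategory.bijective_of_isIso (j'.stalkMap y)).1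
  have := isReduced_of_isReduced_stalk G
  exact hZ (isIso_of_isClosedImmersion_of_surjective i)

end JetSeparation

/-! ### Construction of the section -/

theorem mainTheorem5
    -- a complete discrete valuation ring with fraction field `K`
    (R : Type u) [CommRing R] [IsDomain R] [IsDiscreteValuationRing R]
    [IsAdicComplete (IsLocalRing.maximalIdeal R) R]
    (K : Type u) [Field K] [Algebra R K] [IsFractionRing R K]
    -- a connected scheme, smooth and separated over `R`, with a section `e`
    (G : Scheme.{u}) [ConnectedSpace G] (p : G ⟶ Spec (.of R)) [Smooth p] [IsSeparated p]
    (e : Spec (.of R) ⟶ G) (he : e ≫ p = 𝟙 (Spec (.of R)))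
    -- a closed subscheme `i : Z ⟶ G`, different from `G`, that contains `e(Spec R)`
    (Z : Scheme.{u}) (i : Z ⟶ G) [IsClosedImmersion i] (hZ : ¬ IsIso i)
    (heZ : JetSeparation.FactorsThrough e i)
    (a : ℕ) (ha : 0 < a) :
    ∃ b : ℕ, a < b ∧ ∃ σ : Spec (.of R) ⟶ G, σ ≫ p = 𝟙 (Spec (.of R)) ∧
      -- `σ ≡ e` modulo `𝔪 ^ a`
      JetSeparation.specQuot R (IsLocalRing.maximalIdeal R ^ a) ≫ σ =
        JetSeparation.specQuot R (IsLocalRing.maximalIdeal R ^ a) ≫ e ∧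
      -- `σ(Spec (R ⧸ 𝔪 ^ b)) ⊄ Z`
      ¬ JetSeparation.FactorsThrough
        (JetSeparation.specQuot R (IsLocalRing.maximalIdeal R ^ b) ≫ σ) i ∧
      -- the restriction of `σ` to `Spec K` is a `K`-point of the complement of `Z`
      JetSeparation.FactorsThrough (JetSeparation.specAlg R K ≫ σ)
        (JetSeparation.complement i).ι := by
  obtain ⟨B, _, _, _, n, _, _, hB, j, _, hx, hjp⟩ :=
    Smooth.exists_spec_isStandardEtale_mvPolynomial p (e (IsLocalRing.closedPoint R))
  obtain ⟨e', rfl⟩ : ∃ e', e' ≫ j = e :=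
    ⟨_, IsOpenImmersion.lift_fac j e (range_subset_range_of_closedPoint_mem e j hx)⟩
  obtain ⟨φ₀, rfl⟩ := Spec.map_surjective e'
  have hφ₀ : φ₀.hom.comp (algebraMap R B) = RingHom.id R := by
    rw [Category.assoc, hjp, ← Spec.map_comp, ← Spec.map_id] at he
    exact congr($(Spec.map_injective he).hom)
  let φ : B →ₐ[R] R := { φ₀.hom with commutes' := fun r ↦ congr($hφ₀ r) }
  obtain ⟨J, ε, hε⟩ := IsClosedImmersion.Spec_iff.mp
    (inferInstance : IsClosedImmersion (Limits.pullback.snd i j))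
  have hrange : Set.range (Limits.pullback.snd i j) = j ⁻¹' Set.range i :=
    Scheme.Pullback.range_snd ..
  have hJ : J ≠ ⊥ := by
    rintro rfl
    apply JetSeparation.not_range_subset_of_smooth p i hZ j
    have hiso : IsIso (CommRingCat.ofHom (Ideal.Quotient.mk (⊥ : Ideal B))) :=
      (RingEquiv.quotientBot B).symm.toCommRingCatIso.isIso_hom
    have : IsIso (Limits.pullback.snd i j) := hε ▸ inferInstance
    rintro _ ⟨y, rfl⟩
    change y ∈ j ⁻¹' Set.range i
    rw [← hrange]
    exact (Limits.pullback.snd i j).surjective y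
  obtain ⟨f, hfJ, hf⟩ := Submodule.exists_mem_ne_zero_of_ne_bot hJ
  obtain ⟨ψ, hψφ, hψf⟩ :=
    hB.nonempty_standardEtalePresentation.some.exists_algHom_sub_mem_pow_ne_zero φ hf ha
  obtain ⟨b, hb⟩ : ∃ b, ψ f ∉ IsLocalRing.maximalIdeal R ^ b := by
    by_contra! h
    refine hψf ((Submodule.mem_bot R).mp ?_)
    rw [← Ideal.iInf_pow_eq_bot_of_isLocalRing _ (IsLocalRing.maximalIdeal.isMaximal R).ne_top]
    exact (Submodule.mem_iInf _).mpr h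
  -- Enlarging `b` is harmless because the powers of `𝔪` decrease.
  refine ⟨max (a + 1) b, by omega, Spec.map (CommRingCat.ofHom ψ.toRingHom) ≫ j, ?_, ?_, ?_, ?_⟩
  · rw [Category.assoc, hjp, ← Spec.map_comp, ← Spec.map_id]
    congr 1
    ext r
    exact ψ.commutes r
  · rw [JetSeparation.specQuot, ← Category.assoc, ← Category.assoc, ← Spec.map_comp,
      ← Spec.map_comp]
    congr 2
    ext z
    exact Ideal.Quotient.eq.mpr (hψφ z)
  · intro h
    rw [JetSeparation.specQuot, ← Category.assoc, ← Spec.map_comp, ← CommRingCat.ofHom_comp] at h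
    have h0 := JetSeparation.FactorsThrough.map_eq_zero ε hε h hfJ
    exact hb (Ideal.pow_le_pow_right (le_max_right _ _) (Ideal.Quotient.eq_zero_iff_mem.mp h0))
  · refine ⟨IsOpenImmersion.lift (JetSeparation.complement i).ι _ ?_,
      IsOpenImmersion.lift_fac _ _ _⟩
    rw [Scheme.Opens.range_ι]
    rintro _ ⟨y, rfl⟩ hy
    rw [JetSeparation.specAlg, ← Category.assoc, ← Spec.map_comp, Scheme.Hom.comp_apply] at hy
    change _ ∈ j ⁻¹' Set.range i at hy
    rw [← hrange] at hy
    obtain ⟨z, hz⟩ := hy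
    rw [hε, Scheme.Hom.comp_apply] at hz
    -- A point of `Spec K` over `Z` would put `ψ f` in a prime of `K`, where it is a unit.
    have hmem : f ∈ (Spec.map (CommRingCat.ofHom (Ideal.Quotient.mk J)) (ε.hom z)).asIdeal := by
      change Ideal.Quotient.mk J f ∈ (ε.hom z).asIdeal
      rw [Ideal.Quotient.eq_zero_iff_mem.mpr hfJ]
      exact zero_mem _
    rw [hz] at hmem
    change algebraMap R K (ψ f) ∈ y.asIdeal at hmem
    refine y.2.ne_top (Ideal.eq_top_of_isUnit_mem _ hmem (IsUnit.mk0 _ ?_))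
    simpa using hψf
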